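/- Let $G=(V,E)$ be a finite, undirected, connected graph without loops or parallel edges, with $n=|V|\ge 2$ vertices. Write $d_x$ for the degree of $x\in V$, $d_{\min}$ for the minimum degree and $d_{\rm avg}$ for the average degree. Let $P$ be the transition matrix of lazy random walk on $G$, i.e. $P(x,x)=\frac12$, $P(x,y)=\frac1{2d_x}$ if $xy\in E$, and $P(x,y)=0$ otherwise; let $\pi(x)=\frac{d_x}{d_{\rm avg}\,n}$ be its stationary distribution. Let $1=\lambda_1>\lambda_2\ge\dots\ge\lambda_n\ge 0$ be the eigenvalues of $P$, with multiplicity, and let $t_{\rm rel}=(1-\lambda_2)^{-1}$ be the relaxation time. Then for every $x\in V$ and every integer $t\ge 0$, \[ P^t(x,x)-\pi(x)\;\le\;\frac{10\,d_x}{d_{\min}}\,\min\left\{\frac{1}{\sqrt{t+1}},\;\frac{\sqrt{t_{\rm rel}+1}}{t+1}\right\}. \] -/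

import Mathlib

noncomputable section

namespace LazyWalk

variable {V : Type*} [Fintype V] [DecidableEq V]

/-- Transition matrix of lazy random walk on `G`. -/
def transitionMatrix (G : SimpleGraph V) [DecidableRel G.Adj] : Matrix V V ℝ :=
  Matrix.of fun x y =>
    if y = x then 1 / 2 else if G.Adj x y then 1 / (2 * (G.degree x : ℝ)) else 0

/-- Average degree of `G`. -/
def avgDegree (G : SimpleGraph V) [DecidableRel G.Adj] : ℝ :=
  (∑ x, (G.degree x : ℝ)) / (Fintype.card V : ℝ)

/-- Stationary distribution `π(x) = d_x / (d_avg n)`. -/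
def stationary (G : SimpleGraph V) [DecidableRel G.Adj] (x : V) : ℝ :=
  (G.degree x : ℝ) / (avgDegree G * (Fintype.card V : ℝ))

/-- The real eigenvalues of a matrix, with algebraic multiplicity, in decreasing order. -/
def eigenvalueList (P : Matrix V V ℝ) : List ℝ :=
  P.charpoly.roots.sort (· ≥ ·)

/-- The second largest eigenvalue `λ₂`, counted with multiplicity
(the list is indexed from `0`; the default value `0` is used only for lists of length `< 2`). -/
def lambdaTwo (P : Matrix V V ℝ) : ℝ :=
  (eigenvalueList P).getD 1 0

/-- Relaxation time `t_rel = (1 - λ₂)⁻¹` of lazy random walk on `G`. -/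
def relaxationTime (G : SimpleGraph V) [DecidableRel G.Adj] : ℝ :=
  (1 - lambdaTwo (transitionMatrix G))⁻¹

end LazyWalk

end

/-!
Let `π` be the stationary distribution, `d` the degree function and `δ` the minimal degree. The
excess `a t = P ^ t (x, x) - π x` equals `d x * ∑ i ≠ 0, λ i ^ t * φ i x ^ 2` in an eigenbasis of
`P`. As `0 ≤ λ i ≤ 1`, both `a` and its decrements `a t - a (t + 1)` are nonnegative and
nonincreasing. Moreover `2 * d x * (a (2 * t) - a (2 * t + 1))` is the Dirichlet energy of the
function `f y = P ^ t (y, x) - π x`, for which `f x = a t` and `∑ y, d y * (f y)⁺ ≤ d x` by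
reversibility. The Nash inequality `δ ^ 2 * f x ^ 3 ≤ 96 * (∑ y, d y * (f y)⁺) * energy f` gives
`h t ^ 3 ≤ 192 * (h (2 * t) - h (2 * t + 1)) ≤ 192 * (h t - h (t + 1))` for `h = (δ / d x) * a`.
This forces `h t ≤ 10 / √(t + 1)`, the first bound. After the relaxation time, the decay of `a` at
the geometric rate `λ₂` makes `(t + 1) * a t` nonincreasing, which gives the second bound.
-/

namespace LazyWalk

open Finset Matrix RCLike

section Sequences

variable {h : ℕ → ℝ}

theorem sq_mul_succ_le_of_cube_le {K : ℝ} (hK : 0 < K) (hnn : ∀ n, 0 ≤ h n) (h0 : h 0 ^ 2 ≤ K)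
    (hstep : ∀ n, h n ^ 3 ≤ 2 * K * (h n - h (n + 1))) (n : ℕ) :
    h n ^ 2 * ((n : ℝ) + 1) ≤ K := by
  induction n with
  | zero => simpa using h0
  | succ n ih =>
    set y := h n ^ 2 with hy
    have hy0 : 0 ≤ y := sq_nonneg _
    have hyK : y ≤ K := (le_mul_of_one_le_right hy0 (by simp)).trans ih
    have hnext : 2 * K * h (n + 1) ≤ h n * (2 * K - y) := by
      linear_combination hstep n + h n * hy
    have hnext_sq : 4 * K ^ 2 * h (n + 1) ^ 2 ≤ y * (2 * K - y) ^ 2 := by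
      linear_combination pow_le_pow_left₀ (mul_nonneg (by positivity) (hnn (n + 1))) hnext 2
    have hcubic : (2 * K - y) ^ 2 * (K + y) ≤ 4 * K ^ 3 := by
      nlinarith [mul_nonneg (sq_nonneg y) (show 0 ≤ 3 * K - y by linarith)]
    have hnext_mul : h (n + 1) ^ 2 * (K + y) ≤ K * y := by
      refine le_of_mul_le_mul_left ?_ (show 0 < 4 * K ^ 2 by positivity)
      linear_combination (K + y) * hnext_sq + y * hcubic
    rcases hy0.eq_or_lt with hzero | hpos
    · rw [← hzero, mul_zero, add_zero] at hnext_mul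
      have : h (n + 1) ^ 2 = 0 :=
        le_antisymm (nonpos_of_mul_nonpos_left hnext_mul hK) (sq_nonneg _)
      simpa [this] using hK.le
    · refine le_of_mul_le_mul_left ?_ hpos
      push_cast
      linear_combination hnext_mul + h (n + 1) ^ 2 * ih

theorem le_div_sqrt_of_cube_le {C : ℝ} (hC : 0 < C) (hnn : ∀ n, 0 ≤ h n) (h0 : h 0 ≤ C)
    (hstep : ∀ n, h n ^ 3 ≤ 2 * C ^ 2 * (h n - h (n + 1))) (n : ℕ) :
    h n ≤ C / √((n : ℝ) + 1) := by
  have hsq := sq_mul_succ_le_of_cube_le (pow_pos hC 2) hnn (pow_le_pow_left₀ (hnn 0) h0 2) hstep n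
  rw [le_div_iff₀ (by positivity)]
  refine le_of_sq_le_sq ?_ hC.le
  rwa [mul_pow, Real.sq_sqrt (by positivity)]

theorem le_sqrt_inv_one_sub_div_of_le_div_sqrt {b : ℕ → ℝ} {r C : ℝ} (hr : r < 1)
    (hnn : ∀ n, 0 ≤ b n) (hgeom : ∀ n, b (n + 1) ≤ r * b n)
    (hb : ∀ n : ℕ, b n ≤ C / √((n : ℝ) + 1)) (n : ℕ) :
    b n ≤ C * √((1 - r)⁻¹ + 1) / ((n : ℝ) + 1) := by
  have hC : 0 ≤ C := by simpa using (hnn 0).trans (hb 0)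
  have hr' : 0 < 1 - r := sub_pos.2 hr
  have of_le (n : ℕ) (hn : (n : ℝ) ≤ (1 - r)⁻¹) :
      b n * ((n : ℝ) + 1) ≤ C * √((1 - r)⁻¹ + 1) :=
    calc b n * ((n : ℝ) + 1) = b n * √((n : ℝ) + 1) * √((n : ℝ) + 1) := by
          rw [mul_assoc, Real.mul_self_sqrt (by positivity)]
      _ ≤ C * √((1 - r)⁻¹ + 1) := by
          exact mul_le_mul ((le_div_iff₀ (by positivity)).1 (hb n))
            (Real.sqrt_le_sqrt (by linarith)) (Real.sqrt_nonneg _) hC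
  rw [le_div_iff₀ (by positivity)]
  induction n with
  | zero => exact of_le 0 (by simpa using hr'.le)
  | succ n ih =>
    rcases le_or_gt ((n + 1 : ℕ) : ℝ) (1 - r)⁻¹ with hle | hlt
    · exact of_le _ hle
    · -- Past the time `(1 - r)⁻¹`, the ratio `(n + 2) / (n + 1)` is at most `r⁻¹`.
      have hratio : r * ((n : ℝ) + 2) ≤ n + 1 := by
        have : 1 < (1 - r) * ((n : ℝ) + 1) := by
          rw [inv_lt_iff_one_lt_mul₀' hr'] at hlt
          exact_mod_cast hlt
        linarith
      refine le_trans ?_ ih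
      push_cast
      linear_combination ((n : ℝ) + 2) * hgeom n + mul_le_mul_of_nonneg_left hratio (hnn n)

end Sequences

section Nash

variable {V : Type*}

theorem dist_getVert_of_length_eq_dist {G : SimpleGraph V} {x y : V} {p : G.Walk x y}
    (hp : p.length = G.dist x y) {i : ℕ} (hi : i ≤ p.length) : G.dist x (p.getVert i) = i := by
  rw [← SimpleGraph.length_eq_dist_of_subwalk hp (p.isSubwalk_take i),
    SimpleGraph.Walk.take_length, min_eq_left hi]

theorem card_filter_adj_getVert_le_three (G : SimpleGraph V) [DecidableRel G.Adj] {x y : V}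
    {p : G.Walk x y} (hp : p.length = G.dist x y) (z : V) :
    #{i ∈ range p.length | G.Adj (p.getVert i) z} ≤ 3 := by
  have hsub : {i ∈ range p.length | G.Adj (p.getVert i) z} ⊆
      Icc (G.dist x z - 1) (G.dist x z + 1) := by
    intro i hi
    obtain ⟨hip, hadj⟩ := mem_filter.1 hi
    have hdist := dist_getVert_of_length_eq_dist hp (mem_range.1 hip).le
    have := hadj.diff_dist_adj (u := x)
    rw [mem_Icc]
    omega
  have := card_le_card hsub
  rw [Nat.card_Icc] at this
  omega

theorem exists_walk_length_eq_dist_to_lt {G : SimpleGraph V} (hG : G.Preconnected) {f : V → ℝ}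
    {c : ℝ} (x : V) {y : V} (hy : f y < c) : ∃ z, f z < c ∧ ∃ p : G.Walk x z,
      p.length = G.dist x z ∧ ∀ i < p.length, c ≤ f (p.getVert i) := by
  obtain ⟨z, hz, hmin⟩ := (measure (G.dist x)).wf.has_min {z | f z < c} ⟨y, hy⟩
  obtain ⟨p, hp⟩ := (hG x z).exists_walk_length_eq_dist
  refine ⟨z, hz, p, hp, fun i hi => not_lt.1 fun hlt => hmin (p.getVert i) hlt ?_⟩
  change G.dist x (p.getVert i) < G.dist x z
  rwa [dist_getVert_of_length_eq_dist hp hi.le, ← hp]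

variable [Fintype V] (G : SimpleGraph V) [DecidableRel G.Adj]

theorem sum_sum_neighborFinset (g : V → ℝ) :
    ∑ y, ∑ z ∈ G.neighborFinset y, g z = ∑ z, G.degree z * g z := by
  rw [sum_comm' (t' := univ) (s' := fun z => G.neighborFinset z) (by simp [G.adj_comm])]
  simp

theorem sum_sum_neighborFinset_getVert_le {x y : V} {p : G.Walk x y}
    (hp : p.length = G.dist x y) {g : V → ℝ} (hg : 0 ≤ g) :
    ∑ i ∈ range p.length, ∑ z ∈ G.neighborFinset (p.getVert i), g z ≤ 3 * ∑ z, g z := by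
  calc ∑ i ∈ range p.length, ∑ z ∈ G.neighborFinset (p.getVert i), g z
      = ∑ z, #{i ∈ range p.length | G.Adj (p.getVert i) z} * g z := by
        rw [sum_comm' (t' := univ) (s' := fun z => {i ∈ range p.length | G.Adj (p.getVert i) z})
          (by simp)]
        simp
    _ ≤ ∑ z, 3 * g z := by
        gcongr with z
        · exact hg z
        · exact_mod_cast card_filter_adj_getVert_le_three G hp z
    _ = 3 * ∑ z, g z := (mul_sum ..).symm

theorem length_mul_minDegree_mul_le {x y : V} {p : G.Walk x y} (hp : p.length = G.dist x y)
    {f : V → ℝ} {c : ℝ}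
    (hc : ∀ i < p.length, G.degree (p.getVert i) * c ≤ ∑ z ∈ G.neighborFinset (p.getVert i), f z)
    (hc0 : 0 ≤ c) : p.length * (G.minDegree * c) ≤ 3 * ∑ z, (f z)⁺ :=
  calc p.length * (G.minDegree * c)
      = ∑ _i ∈ range p.length, G.minDegree * c := by simp
    _ ≤ ∑ i ∈ range p.length, ∑ z ∈ G.neighborFinset (p.getVert i), (f z)⁺ := by
        refine sum_le_sum fun i hi => ?_
        calc (G.minDegree * c : ℝ) ≤ G.degree (p.getVert i) * c := by
              gcongr; exact G.minDegree_le_degree _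
          _ ≤ ∑ z ∈ G.neighborFinset (p.getVert i), f z := hc i (mem_range.1 hi)
          _ ≤ ∑ z ∈ G.neighborFinset (p.getVert i), (f z)⁺ := by
              gcongr; exact le_posPart _
    _ ≤ 3 * ∑ z, (f z)⁺ := sum_sum_neighborFinset_getVert_le G hp fun z => posPart_nonneg _

theorem minDegree_mul_sum_posPart_le (f : V → ℝ) :
    G.minDegree * ∑ z, (f z)⁺ ≤ ∑ z, G.degree z * (f z)⁺ := by
  rw [mul_sum]
  gcongr with z
  exact G.minDegree_le_degree z

variable [DecidableEq V]

/-- The Dirichlet energy of `f` for unit conductances, half the sum of `(f y - f z) ^ 2` over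
ordered pairs of adjacent vertices. -/
def dirichletEnergy (f : V → ℝ) : ℝ :=
  f ⬝ᵥ G.lapMatrix ℝ *ᵥ f

theorem two_mul_dirichletEnergy (f : V → ℝ) :
    2 * dirichletEnergy G f = ∑ y, ∑ z ∈ G.neighborFinset y, (f y - f z) ^ 2 := by
  rw [dirichletEnergy, ← toLinearMap₂'_apply', G.lapMatrix_toLinearMap₂' ℝ,
    mul_div_cancel₀ _ two_ne_zero]
  simp only [← sum_filter, G.neighborFinset_eq_filter]

theorem dirichletEnergy_nonneg (f : V → ℝ) : 0 ≤ dirichletEnergy G f := by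
  simpa [dirichletEnergy] using (G.posSemidef_lapMatrix ℝ).dotProduct_mulVec_nonneg f

theorem eq_of_dirichletEnergy_eq_zero {G : SimpleGraph V} [DecidableRel G.Adj] (hG : G.Preconnected)
    {f : V → ℝ} (hf : dirichletEnergy G f = 0) (y z : V) : f y = f z :=
  (G.lapMatrix_toLinearMap₂'_apply'_eq_zero_iff_forall_reachable f).1
    ((toLinearMap₂'_apply' ..).trans hf) y z (hG y z)

theorem dirichletEnergy_le (f : V → ℝ) :
    dirichletEnergy G f ≤ 2 * ∑ y, G.degree y * f y ^ 2 := by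
  refine le_of_mul_le_mul_left ?_ (zero_lt_two' ℝ)
  calc 2 * dirichletEnergy G f
      ≤ ∑ y, ∑ z ∈ G.neighborFinset y, (2 * f y ^ 2 + 2 * f z ^ 2) := by
        rw [two_mul_dirichletEnergy]
        gcongr with y _ z
        linarith [sq_nonneg (f y + f z)]
    _ = 2 * (2 * ∑ y, G.degree y * f y ^ 2) := by
        simp only [sum_add_distrib, sum_sum_neighborFinset G (fun z => 2 * f z ^ 2), mul_sum,
          sum_const, G.card_neighborFinset_eq_degree, nsmul_eq_mul]
        rw [← sum_add_distrib]
        exact sum_congr rfl fun y _ => by ring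

theorem sum_sum_neighborFinset_sq_sub_le (f : V → ℝ) (s : Finset V) :
    ∑ y ∈ s, ∑ z ∈ G.neighborFinset y, (f y - f z) ^ 2 ≤ 2 * dirichletEnergy G f := by
  rw [two_mul_dirichletEnergy]
  exact sum_le_univ_sum_of_nonneg fun y => sum_nonneg fun z _ => sq_nonneg _

theorem degree_mul_sq_le_two_mul_dirichletEnergy {f : V → ℝ} {w : V} {c : ℝ} (hc : 0 ≤ c)
    (hw : G.degree w * c ≤ (G.lapMatrix ℝ *ᵥ f) w) :
    G.degree w * c ^ 2 ≤ 2 * dirichletEnergy G f := by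
  have hlap : (G.lapMatrix ℝ *ᵥ f) w = ∑ z ∈ G.neighborFinset w, (f w - f z) := by
    simp [G.lapMatrix_mulVec_apply]
  have hexpand : ∑ z ∈ G.neighborFinset w, (f w - f z - c) ^ 2 =
      ∑ z ∈ G.neighborFinset w, (f w - f z) ^ 2 - 2 * c * (G.lapMatrix ℝ *ᵥ f) w +
        G.degree w * c ^ 2 := by
    rw [hlap, mul_sum, ← sum_sub_distrib, ← G.card_neighborFinset_eq_degree, ← nsmul_eq_mul,
      ← sum_const, ← sum_add_distrib]
    exact sum_congr rfl fun z _ => by ring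
  have hsq : 0 ≤ ∑ z ∈ G.neighborFinset w, (f w - f z - c) ^ 2 := sum_nonneg fun z _ => sq_nonneg _
  have hlocal := sum_sum_neighborFinset_sq_sub_le G f {w}
  rw [sum_singleton] at hlocal
  linear_combination hlocal + hsq + hexpand + 2 * c * hw

theorem sq_sub_le_length_mul_dirichletEnergy {x y : V} {p : G.Walk x y} (hp : p.IsPath)
    (f : V → ℝ) : (f x - f y) ^ 2 ≤ p.length * (2 * dirichletEnergy G f) := by
  have hinj : Set.InjOn p.getVert (range p.length) := hp.getVert_injOn.mono fun i hi => by
    simpa using (mem_range.1 hi).le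
  calc (f x - f y) ^ 2
      = (∑ i ∈ range p.length, (f (p.getVert i) - f (p.getVert (i + 1)))) ^ 2 := by
        rw [sum_range_sub' fun i => f (p.getVert i), p.getVert_zero, p.getVert_length]
    _ ≤ p.length * ∑ i ∈ range p.length, (f (p.getVert i) - f (p.getVert (i + 1))) ^ 2 := by
        simpa using sq_sum_le_card_mul_sum_sq (s := range p.length)
          (f := fun i => f (p.getVert i) - f (p.getVert (i + 1)))
    _ ≤ p.length * ∑ i ∈ range p.length, ∑ z ∈ G.neighborFinset (p.getVert i),
          (f (p.getVert i) - f z) ^ 2 := by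
        gcongr with i hi
        exact single_le_sum (f := fun z => (f (p.getVert i) - f z) ^ 2)
          (fun z _ => sq_nonneg _)
          ((G.mem_neighborFinset ..).2 (p.adj_getVert_succ (mem_range.1 hi)))
    _ = p.length * ∑ w ∈ (range p.length).image p.getVert, ∑ z ∈ G.neighborFinset w,
          (f w - f z) ^ 2 := by
        rw [sum_image hinj]
    _ ≤ p.length * (2 * dirichletEnergy G f) := by
        gcongr
        exact sum_sum_neighborFinset_sq_sub_le G f _

variable {G}

/- On a geodesic from `x` to the nearest vertex where `f < f x / 2`, either the Laplacian of `f` is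
large somewhere, or every vertex sees much of the mass of `f` in its neighbourhood. As these
neighbourhoods overlap at most three times, the geodesic is then short and `f` drops fast along it.
-/
theorem nash_inequality (hG : G.Preconnected) {f : V → ℝ} {y : V} (hy : f y ≤ 0)
    (x : V) : (G.minDegree : ℝ) ^ 2 * f x ^ 3 ≤
      96 * (∑ z, G.degree z * (f z)⁺) * dirichletEnergy G f := by
  set E := dirichletEnergy G f
  set M := ∑ z, G.degree z * (f z)⁺
  set δ : ℝ := (G.minDegree : ℝ)
  have hE0 : 0 ≤ E := dirichletEnergy_nonneg G f
  have hδ0 : 0 ≤ δ := Nat.cast_nonneg _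
  have hδM : δ * ∑ z, (f z)⁺ ≤ M := minDegree_mul_sum_posPart_le G f
  have hM0 : 0 ≤ M := hδM.trans' (mul_nonneg hδ0 (sum_nonneg fun z _ => posPart_nonneg _))
  rcases le_or_gt (f x) 0 with hx | hx
  · exact (mul_nonpos_of_nonneg_of_nonpos (sq_nonneg δ) (Odd.pow_nonpos (by decide) hx)).trans
      (by positivity)
  obtain ⟨z, hz, p, hp, hbig⟩ := exists_walk_length_eq_dist_to_lt hG x (hy.trans_lt (half_pos hx))
  by_cases! hlap : ∃ i < p.length,
    G.degree (p.getVert i) * (f x / 4) ≤ (G.lapMatrix ℝ *ᵥ f) (p.getVert i)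
  · obtain ⟨i, -, hi⟩ := hlap
    have hlocal : δ * (f x / 4) ^ 2 ≤ 2 * E :=
      le_trans (by gcongr; exact Nat.cast_le.2 (G.minDegree_le_degree _))
        (degree_mul_sq_le_two_mul_dirichletEnergy G (by positivity) hi)
    have hpoint : δ * f x ≤ M := hδM.trans' <| mul_le_mul_of_nonneg_left ((le_posPart _).trans <|
      single_le_sum (f := fun z => (f z)⁺) (fun z _ => posPart_nonneg _) (mem_univ x)) hδ0
    linear_combination 16 * (δ * f x) * hlocal + 32 * E * hpoint + 64 * mul_nonneg hM0 hE0
  · have hlength : p.length * (δ * (f x / 4)) ≤ 3 * ∑ z, (f z)⁺ := by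
      refine length_mul_minDegree_mul_le G hp (fun i hi => ?_) (by positivity)
      have := hlap i hi
      rw [G.lapMatrix_mulVec_apply] at this
      linear_combination this + (G.degree (p.getVert i) : ℝ) * hbig i hi
    have hdrop : (f x / 2) ^ 2 ≤ p.length * (2 * E) :=
      le_trans (by gcongr; linarith)
        (sq_sub_le_length_mul_dirichletEnergy G (p.isPath_of_length_eq_dist hp) f)
    linear_combination 4 * δ ^ 2 * f x * hdrop + 32 * δ * E * hlength + 96 * E * hδM

end Nash

section Reversible

variable {V : Type*} [Fintype V]

theorem wInner_real_eq_sum (m f g : V → ℝ) : ⟪f, g⟫_[ℝ, m] = ∑ y, m y * (f y * g y) := by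
  simp [wInner, mul_comm]

/-- Detailed balance: `m` is a reversible measure, not necessarily normalized, for the kernel
`P`. -/
def IsReversible (m : V → ℝ) (P : Matrix V V ℝ) : Prop :=
  ∀ y z, m y * P y z = m z * P z y

variable {m : V → ℝ} {P : Matrix V V ℝ}

theorem IsReversible.wInner_mulVec_left (hP : IsReversible m P) (f g : V → ℝ) :
    ⟪P *ᵥ f, g⟫_[ℝ, m] = ⟪f, P *ᵥ g⟫_[ℝ, m] := by
  simp only [wInner_real_eq_sum, mulVec, dotProduct, mul_sum, sum_mul]
  rw [sum_comm]
  refine sum_congr rfl fun y _ => sum_congr rfl fun z _ => ?_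
  linear_combination f y * g z * hP z y

variable [DecidableEq V]

theorem IsReversible.pow (hP : IsReversible m P) (t : ℕ) : IsReversible m (P ^ t) := by
  have hsemi : SemiconjBy (diagonal m) P Pᵀ := by
    ext y z
    rw [diagonal_mul, mul_diagonal, transpose_apply, hP y z, mul_comm]
  intro y z
  simpa [← transpose_pow, mul_comm] using congr_fun₂ (hsemi.pow_right t).eq y z

theorem pow_mulVec_eq_self {f : V → ℝ} (hf : P *ᵥ f = f) (t : ℕ) : P ^ t *ᵥ f = f := by
  induction t with
  | zero => simp
  | succ t ih => rw [pow_succ, ← mulVec_mulVec, hf, ih]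

/-- The deviation at time `t` of the probability of being at `x` from its equilibrium value, as a
function of the starting point. -/
noncomputable def deviation (m : V → ℝ) (P : Matrix V V ℝ) (x : V) (t : ℕ) : V → ℝ :=
  P ^ t *ᵥ Pi.single x 1 - (m x / ∑ z, m z) • 1

theorem deviation_apply (x : V) (t : ℕ) (y : V) :
    deviation m P x t y = (P ^ t) y x - m x / ∑ z, m z := by
  simp [deviation]

theorem pow_mulVec_deviation (hP : P *ᵥ 1 = 1) (x : V) (s t : ℕ) :
    P ^ s *ᵥ deviation m P x t = deviation m P x (s + t) := by
  rw [deviation, mulVec_sub, mulVec_mulVec, ← pow_add, mulVec_smul, pow_mulVec_eq_self hP,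
    deviation]

theorem wInner_one_deviation (hrev : IsReversible m P) (hP : P *ᵥ 1 = 1) (hm : ∑ z, m z ≠ 0)
    (x : V) (t : ℕ) : ⟪1, deviation m P x t⟫_[ℝ, m] = 0 := by
  rw [← add_zero t, ← pow_mulVec_deviation hP, ← (hrev.pow t).wInner_mulVec_left,
    pow_mulVec_eq_self hP, wInner_real_eq_sum]
  simp [deviation_apply, one_apply, mul_sub, sum_sub_distrib, ← sum_mul, mul_div_cancel₀ _ hm]

theorem wInner_deviation_deviation (hrev : IsReversible m P) (hP : P *ᵥ 1 = 1)
    (hm : ∑ z, m z ≠ 0) (x : V) (s t : ℕ) :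
    ⟪deviation m P x s, deviation m P x t⟫_[ℝ, m] = m x * deviation m P x (s + t) x := by
  rw [← add_zero s, ← pow_mulVec_deviation hP, (hrev.pow s).wInner_mulVec_left,
    pow_mulVec_deviation hP, add_zero, deviation, pow_zero, one_mulVec, wInner_sub_left,
    wInner_smul_left, wInner_one_deviation hrev hP hm, smul_zero, sub_zero, wInner_real_eq_sum]
  simp [Pi.single_apply]

theorem exists_deviation_nonpos (hrev : IsReversible m P) (hP : P *ᵥ 1 = 1) (hm : ∀ y, 0 < m y)
    (x : V) (t : ℕ) : ∃ y, deviation m P x t y ≤ 0 := by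
  have hsum : ∑ z, m z ≠ 0 := (sum_pos (fun z _ => hm z) ⟨x, mem_univ x⟩).ne'
  by_contra! hpos
  refine (wInner_one_deviation hrev hP hsum x t).not_gt ?_
  rw [wInner_real_eq_sum]
  exact sum_pos (fun y _ => mul_pos (hm y) (by simpa using hpos y)) ⟨x, mem_univ x⟩

theorem sum_mul_posPart_deviation_le (hrev : IsReversible m P) (hP : P ∈ rowStochastic ℝ V)
    (hm : 0 ≤ m) (x : V) (t : ℕ) : ∑ y, m y * (deviation m P x t y)⁺ ≤ m x := by
  have hPt := pow_mem hP t
  calc ∑ y, m y * (deviation m P x t y)⁺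
      ≤ ∑ y, m y * (P ^ t) y x := by
        gcongr with y
        · exact hm y
        · rw [deviation_apply]
          exact sup_le (sub_le_self _ (div_nonneg (hm x) (sum_nonneg fun z _ => hm z)))
            (nonneg_of_mem_rowStochastic hPt)
    _ = m x * ∑ y, (P ^ t) x y := by
        rw [mul_sum]
        exact sum_congr rfl fun y _ => hrev.pow t y x
    _ = m x := by rw [sum_row_of_mem_rowStochastic hPt, mul_one]

end Reversible

section Spectral

variable {V : Type*} [Fintype V] [DecidableEq V] {m : V → ℝ} {P : Matrix V V ℝ}

/-- A spectral decomposition of `P` in `ℓ²(m)`: eigenfunctions that are orthonormal for the weights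
`m`, ordered so that the eigenvalues decrease. -/
structure SpectralDecomposition (m : V → ℝ) (P : Matrix V V ℝ) where
  /-- The eigenvalues, with multiplicity. -/
  eigenvalue : Fin (Fintype.card V) → ℝ
  /-- The eigenfunctions. -/
  eigenfunction : Fin (Fintype.card V) → V → ℝ
  antitone_eigenvalue : Antitone eigenvalue
  eigenvalueList_eq : eigenvalueList P = List.ofFn eigenvalue
  mulVec_eigenfunction (i) : P *ᵥ eigenfunction i = eigenvalue i • eigenfunction i
  wInner_eigenfunction (i j) :
    ⟪eigenfunction i, eigenfunction j⟫_[ℝ, m] = if i = j then 1 else 0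

/-- The symmetric matrix with entries `√(m y) * P y z / √(m z)`, similar to `P`. -/
noncomputable def symmetrization (m : V → ℝ) (P : Matrix V V ℝ) : Matrix V V ℝ :=
  diagonal (fun y => √(m y)) * P * diagonal fun y => (√(m y))⁻¹

theorem symmetrization_apply (y z : V) :
    symmetrization m P y z = √(m y) * P y z * (√(m z))⁻¹ := by
  rw [symmetrization, mul_diagonal, diagonal_mul]

theorem charpoly_symmetrization (hm : ∀ y, 0 < m y) :
    (symmetrization m P).charpoly = P.charpoly := by
  rw [symmetrization, charpoly_mul_comm, ← mul_assoc, diagonal_mul_diagonal]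
  simp [inv_mul_cancel₀ (Real.sqrt_pos.2 (hm _)).ne']

theorem IsReversible.isHermitian_symmetrization (hP : IsReversible m P) (hm : ∀ y, 0 < m y) :
    (symmetrization m P).IsHermitian := by
  ext y z
  have hy := (Real.sqrt_pos.2 (hm y)).ne'
  have hz := (Real.sqrt_pos.2 (hm z)).ne'
  have hyz := hP y z
  rw [← Real.sq_sqrt (hm y).le, ← Real.sq_sqrt (hm z).le] at hyz
  rw [conjTranspose_apply, star_trivial, symmetrization_apply, symmetrization_apply]
  field_simp
  linear_combination -hyz

theorem mulVec_inv_sqrt_mul_of_symmetrization_mulVec (hm : ∀ y, 0 < m y) {u : V → ℝ} {μ : ℝ}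
    (hu : symmetrization m P *ᵥ u = μ • u) :
    (P *ᵥ fun y => (√(m y))⁻¹ * u y) = μ • fun y => (√(m y))⁻¹ * u y := by
  ext y
  have hy := (Real.sqrt_pos.2 (hm y)).ne'
  refine mul_left_cancel₀ hy ?_
  calc √(m y) * (P *ᵥ fun z => (√(m z))⁻¹ * u z) y
      = (symmetrization m P *ᵥ u) y := by
        simp only [mulVec, dotProduct, symmetrization_apply, mul_sum, mul_assoc]
    _ = √(m y) * (μ * ((√(m y))⁻¹ * u y)) := by
        rw [hu, Pi.smul_apply, smul_eq_mul]
        field_simp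

omit [DecidableEq V] in
theorem wInner_inv_sqrt_mul_inv_sqrt_mul (hm : ∀ y, 0 < m y) (u v : V → ℝ) :
    ⟪fun y => (√(m y))⁻¹ * u y, fun y => (√(m y))⁻¹ * v y⟫_[ℝ, m] = u ⬝ᵥ v := by
  rw [wInner_real_eq_sum, dotProduct]
  refine sum_congr rfl fun y _ => ?_
  have hy : m y * (√(m y))⁻¹ ^ 2 = 1 := by
    rw [inv_pow, Real.sq_sqrt (hm y).le, mul_inv_cancel₀ (hm y).ne']
  linear_combination u y * v y * hy

/-- The spectral decomposition obtained by diagonalizing the symmetrization of `P`. -/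
noncomputable def IsReversible.spectralDecomposition (hP : IsReversible m P) (hm : ∀ y, 0 < m y) :
    SpectralDecomposition m P :=
  let hS := hP.isHermitian_symmetrization hm
  let e := Fintype.equivOfCardEq (Fintype.card_fin (Fintype.card V))
  { eigenvalue := hS.eigenvalues₀
    eigenfunction i y := (√(m y))⁻¹ * hS.eigenvectorBasis (e i) y
    antitone_eigenvalue := hS.eigenvalues₀_antitone
    eigenvalueList_eq := by
      rw [eigenvalueList, ← charpoly_symmetrization hm, ← hS.sort_roots_charpoly_eq_eigenvalues₀]
      exact congrArg (Multiset.sort · (· ≥ ·)) (Multiset.map_id _).symm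
    mulVec_eigenfunction i := mulVec_inv_sqrt_mul_of_symmetrization_mulVec hm <| by
      simpa [e, IsHermitian.eigenvalues] using hS.mulVec_eigenvectorBasis (e i)
    wInner_eigenfunction i j := by
      have horth := orthonormal_iff_ite.1 hS.eigenvectorBasis.orthonormal (e i) (e j)
      simp only [e.injective.eq_iff] at horth
      rw [wInner_inv_sqrt_mul_inv_sqrt_mul hm, ← horth, PiLp.inner_apply, dotProduct]
      simp [mul_comm] }

namespace SpectralDecomposition

variable (B : SpectralDecomposition m P)

theorem lambdaTwo_eq (hV : 1 < Fintype.card V) : lambdaTwo P = B.eigenvalue ⟨1, hV⟩ := by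
  simp [lambdaTwo, B.eigenvalueList_eq, List.getD_eq_getElem?_getD, hV]

theorem exists_eigenvalue_eq {f : V → ℝ} {μ : ℝ} (hf : P *ᵥ f = μ • f) (hf0 : f ≠ 0) :
    ∃ i, B.eigenvalue i = μ := by
  have hroot : P.charpoly.IsRoot μ := by
    rw [← Matrix.charpoly_toLin', ← Module.End.hasEigenvalue_iff_isRoot_charpoly]
    exact Module.End.hasEigenvalue_of_hasEigenvector (x := f)
      ⟨Module.End.mem_eigenspace_iff.2 (by rw [toLin'_apply, hf]), hf0⟩
  have hmem : μ ∈ eigenvalueList P := by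
    rw [eigenvalueList, Multiset.mem_sort, Polynomial.mem_roots P.charpoly_monic.ne_zero]
    exact hroot
  rwa [B.eigenvalueList_eq, List.mem_ofFn] at hmem

theorem eigenvalue_zero [Nonempty V] (hP : P *ᵥ 1 = 1) (hle : ∀ i, B.eigenvalue i ≤ 1) :
    B.eigenvalue 0 = 1 := by
  obtain ⟨i, hi⟩ := B.exists_eigenvalue_eq (f := 1) (μ := 1) (by rw [hP, one_smul]) one_ne_zero
  exact (hle 0).antisymm (hi ▸ B.antitone_eigenvalue (Fin.zero_le i))

theorem transpose_mul_mul_diagonal :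
    (of B.eigenfunction)ᵀ * (of B.eigenfunction * diagonal m) = 1 := by
  refine (mul_eq_one_comm_of_card_eq _ _ _ (Fintype.card_fin _)).1 ?_
  ext i j
  rw [one_apply, ← B.wInner_eigenfunction i j, wInner_real_eq_sum, mul_apply]
  refine sum_congr rfl fun y _ => ?_
  rw [mul_diagonal, of_apply, transpose_apply, of_apply]
  ring

theorem pow_mulVec_eigenfunction (t : ℕ) (i : Fin (Fintype.card V)) :
    P ^ t *ᵥ B.eigenfunction i = B.eigenvalue i ^ t • B.eigenfunction i := by
  induction t with
  | zero => simp
  | succ t ih =>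
    rw [pow_succ, ← mulVec_mulVec, B.mulVec_eigenfunction, mulVec_smul, ih, smul_smul, pow_succ']

theorem pow_apply (t : ℕ) (y z : V) : (P ^ t) y z =
    m z * ∑ i, B.eigenvalue i ^ t * (B.eigenfunction i y * B.eigenfunction i z) :=
  calc (P ^ t) y z
      = (P ^ t * (of B.eigenfunction)ᵀ * (of B.eigenfunction * diagonal m)) y z := by
        rw [Matrix.mul_assoc, B.transpose_mul_mul_diagonal, Matrix.mul_one]
    _ = ∑ i, (P ^ t *ᵥ B.eigenfunction i) y * (B.eigenfunction i z * m z) := by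
        rw [mul_apply]
        simp only [mul_diagonal, of_apply]
        rfl
    _ = m z * ∑ i, B.eigenvalue i ^ t * (B.eigenfunction i y * B.eigenfunction i z) := by
        simp only [B.pow_mulVec_eigenfunction, Pi.smul_apply, smul_eq_mul, mul_sum]
        exact sum_congr rfl fun i _ => by ring

end SpectralDecomposition

end Spectral

section ReturnProbability

namespace SpectralDecomposition

variable {V : Type*} [Fintype V] [DecidableEq V] {m : V → ℝ} {P : Matrix V V ℝ}
  (B : SpectralDecomposition m P)

theorem sum_mul_eigenfunction_mul_eigenfunction_of_const {i j : Fin (Fintype.card V)}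
    (hi : ∀ y z, B.eigenfunction i y = B.eigenfunction i z)
    (hj : ∀ y z, B.eigenfunction j y = B.eigenfunction j z) (x : V) :
    (∑ y, m y) * (B.eigenfunction i x * B.eigenfunction j x) = if i = j then 1 else 0 := by
  rw [← B.wInner_eigenfunction, wInner_real_eq_sum, sum_mul]
  exact sum_congr rfl fun y _ => by rw [hi y x, hj y x]

theorem mul_sq_eigenfunction_of_const {i : Fin (Fintype.card V)}
    (hi : ∀ y z, B.eigenfunction i y = B.eigenfunction i z) (x : V) :
    m x * B.eigenfunction i x ^ 2 = m x / ∑ y, m y := by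
  have hnorm := B.sum_mul_eigenfunction_mul_eigenfunction_of_const hi hi x
  rw [if_pos rfl] at hnorm
  rw [eq_div_iff (left_ne_zero_of_mul_eq_one hnorm)]
  linear_combination m x * hnorm

theorem eigenfunction_eq_of_eigenvalue_eq_one (hconst : ∀ f, P *ᵥ f = f → ∀ y z, f y = f z)
    {i : Fin (Fintype.card V)} (hi : B.eigenvalue i = 1) (y z : V) :
    B.eigenfunction i y = B.eigenfunction i z :=
  hconst _ (by rw [B.mulVec_eigenfunction, hi, one_smul]) y z

theorem eq_of_eigenvalue_eq_one (hconst : ∀ f, P *ᵥ f = f → ∀ y z, f y = f z)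
    {i j : Fin (Fintype.card V)} (hi : B.eigenvalue i = 1) (hj : B.eigenvalue j = 1) : i = j := by
  have hi' := B.eigenfunction_eq_of_eigenvalue_eq_one hconst hi
  have hj' := B.eigenfunction_eq_of_eigenvalue_eq_one hconst hj
  obtain ⟨x⟩ : Nonempty V := Fintype.card_pos_iff.1 i.pos
  have hii := B.sum_mul_eigenfunction_mul_eigenfunction_of_const hi' hi' x
  have hij := B.sum_mul_eigenfunction_mul_eigenfunction_of_const hi' hj' x
  have hjj := B.sum_mul_eigenfunction_mul_eigenfunction_of_const hj' hj' x
  by_contra hne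
  simp only [hne, if_true, if_false, mul_eq_zero] at hii hij hjj
  rcases hij with h | h | h <;> simp [h] at hii hjj

theorem lambdaTwo_lt_one (hV : 1 < Fintype.card V) (hP : P *ᵥ 1 = 1)
    (hconst : ∀ f, P *ᵥ f = f → ∀ y z, f y = f z) (hle : ∀ i, B.eigenvalue i ≤ 1) :
    lambdaTwo P < 1 := by
  have := Fintype.card_pos_iff.1 (zero_lt_one.trans hV)
  rw [B.lambdaTwo_eq hV]
  refine (hle _).lt_of_ne fun h => ?_
  simpa using congrArg Fin.val (B.eq_of_eigenvalue_eq_one hconst h (B.eigenvalue_zero hP hle))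

variable (hP : P *ᵥ 1 = 1) (hconst : ∀ f, P *ᵥ f = f → ∀ y z, f y = f z)
include hP hconst

theorem deviation_self [Nonempty V] (hle : ∀ i, B.eigenvalue i ≤ 1) (x : V) (t : ℕ) :
    deviation m P x t x =
      m x * ∑ i ∈ univ.erase 0, B.eigenvalue i ^ t * B.eigenfunction i x ^ 2 := by
  have hzero := B.eigenvalue_zero hP hle
  have hconst_zero := B.eigenfunction_eq_of_eigenvalue_eq_one hconst hzero
  rw [deviation_apply, B.pow_apply, ← add_sum_erase univ _ (mem_univ 0), hzero, mul_add,
    ← B.mul_sq_eigenfunction_of_const hconst_zero x, one_pow, one_mul, ← sq, add_sub_cancel_left]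
  simp only [← sq]

variable (hm : 0 ≤ m) (hB : ∀ i, B.eigenvalue i ∈ Set.Icc 0 1)
include hm hB

theorem deviation_self_nonneg (x : V) (t : ℕ) : 0 ≤ deviation m P x t x := by
  have : Nonempty V := ⟨x⟩
  rw [B.deviation_self hP hconst fun i => (hB i).2]
  exact mul_nonneg (hm x) <| sum_nonneg fun i _ =>
    mul_nonneg (pow_nonneg (hB i).1 t) (sq_nonneg _)

theorem antitone_deviation_self_sub_succ (x : V) :
    Antitone fun t => deviation m P x t x - deviation m P x (t + 1) x := by
  have : Nonempty V := ⟨x⟩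
  have hdecr (t : ℕ) : deviation m P x t x - deviation m P x (t + 1) x = m x *
      ∑ i ∈ univ.erase 0,
        B.eigenvalue i ^ t * ((1 - B.eigenvalue i) * B.eigenfunction i x ^ 2) := by
    simp only [B.deviation_self hP hconst fun i => (hB i).2]
    rw [← mul_sub, ← sum_sub_distrib]
    exact congrArg _ (sum_congr rfl fun i _ => by ring)
  intro s t hst
  simp only [hdecr]
  refine mul_le_mul_of_nonneg_left (sum_le_sum fun i _ => ?_) (hm x)
  exact mul_le_mul_of_nonneg_right (pow_le_pow_of_le_one (hB i).1 (hB i).2 hst)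
    (mul_nonneg (sub_nonneg.2 (hB i).2) (sq_nonneg _))

theorem deviation_self_succ_le (hV : 1 < Fintype.card V) (x : V) (t : ℕ) :
    deviation m P x (t + 1) x ≤ lambdaTwo P * deviation m P x t x := by
  have : Nonempty V := ⟨x⟩
  simp only [B.deviation_self hP hconst fun i => (hB i).2]
  rw [mul_left_comm, mul_sum (a := lambdaTwo P)]
  refine mul_le_mul_of_nonneg_left (sum_le_sum fun i hi => ?_) (hm x)
  have hi2 : B.eigenvalue i ≤ lambdaTwo P := by
    rw [B.lambdaTwo_eq hV]
    exact B.antitone_eigenvalue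
      (Fin.le_def.2 (Nat.one_le_iff_ne_zero.2 (Fin.val_ne_zero_iff.2 (ne_of_mem_erase hi))))
  rw [pow_succ', mul_assoc]
  exact mul_le_mul_of_nonneg_right hi2 (mul_nonneg (pow_nonneg (hB i).1 t) (sq_nonneg _))

end SpectralDecomposition

end ReturnProbability

section LazyRandomWalk

variable {V : Type*} [Fintype V] [DecidableEq V] (G : SimpleGraph V) [DecidableRel G.Adj]

/-- The degrees, an unnormalized stationary measure of the walk: `stationary G` is its normalization
to total mass one. -/
abbrev degreeMeasure : V → ℝ := fun y => G.degree y

theorem degMatrix_mul_transitionMatrix :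
    G.degMatrix ℝ * transitionMatrix G = (1 / 2 : ℝ) • (G.degMatrix ℝ + G.adjMatrix ℝ) := by
  ext y z
  rw [SimpleGraph.degMatrix, diagonal_mul, transitionMatrix, of_apply, Matrix.smul_apply,
    Matrix.add_apply, diagonal_apply, G.adjMatrix_apply, smul_eq_mul]
  rcases eq_or_ne y z with rfl | hyz
  · simp only [↓reduceIte, SimpleGraph.irrefl, add_zero]
    ring
  · by_cases hadj : G.Adj y z
    · have : (G.degree y : ℝ) ≠ 0 := by exact_mod_cast hadj.degree_pos_left.ne'
      simp only [hyz, hyz.symm, hadj, ↓reduceIte, zero_add, mul_one]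
      field_simp
    · simp [hyz, hyz.symm, hadj]

theorem isReversible_transitionMatrix : IsReversible (degreeMeasure G) (transitionMatrix G) := by
  have hsymm : (G.degMatrix ℝ * transitionMatrix G).IsSymm := by
    rw [degMatrix_mul_transitionMatrix]
    exact ((G.isSymm_degMatrix ℝ).add G.isSymm_adjMatrix).smul _
  intro y z
  simpa [SimpleGraph.degMatrix] using hsymm.apply z y

theorem degree_mul_sub_transitionMatrix_mulVec (f : V → ℝ) (y : V) :
    G.degree y * (f y - (transitionMatrix G *ᵥ f) y) = (G.lapMatrix ℝ *ᵥ f) y / 2 := by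
  have h := congrFun (congrArg (· *ᵥ f) (degMatrix_mul_transitionMatrix G)) y
  simp only [← mulVec_mulVec, smul_mulVec, add_mulVec, Pi.smul_apply, Pi.add_apply, smul_eq_mul,
    G.degMatrix_mulVec_apply] at h
  rw [SimpleGraph.lapMatrix, sub_mulVec, Pi.sub_apply, G.degMatrix_mulVec_apply]
  linear_combination -h

theorem wInner_sub_transitionMatrix_mulVec (f : V → ℝ) :
    ⟪f, f - transitionMatrix G *ᵥ f⟫_[ℝ, degreeMeasure G] = dirichletEnergy G f / 2 := by
  rw [wInner_real_eq_sum, dirichletEnergy, dotProduct, sum_div]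
  refine sum_congr rfl fun y _ => ?_
  rw [Pi.sub_apply, mul_left_comm, degree_mul_sub_transitionMatrix_mulVec, mul_div_assoc]

theorem SpectralDecomposition.eigenvalue_mem_Icc
    (B : SpectralDecomposition (degreeMeasure G) (transitionMatrix G))
    (i : Fin (Fintype.card V)) : B.eigenvalue i ∈ Set.Icc 0 1 := by
  have hnorm := B.wInner_eigenfunction i i
  rw [if_pos rfl] at hnorm
  have henergy : 1 - B.eigenvalue i = dirichletEnergy G (B.eigenfunction i) / 2 := by
    rw [← wInner_sub_transitionMatrix_mulVec, B.mulVec_eigenfunction, wInner_sub_right,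
      wInner_smul_right, hnorm, smul_eq_mul, mul_one]
  have hle : dirichletEnergy G (B.eigenfunction i) ≤ 2 := by
    have := dirichletEnergy_le G (B.eigenfunction i)
    simp only [sq, ← wInner_real_eq_sum (degreeMeasure G), hnorm] at this
    linarith
  have hnn := dirichletEnergy_nonneg G (B.eigenfunction i)
  constructor <;> linarith

variable {G}

theorem transitionMatrix_mulVec_one (hdeg : ∀ y, 0 < G.degree y) : transitionMatrix G *ᵥ 1 = 1 := by
  ext y
  have h := degree_mul_sub_transitionMatrix_mulVec G 1 y
  have hzero : G.lapMatrix ℝ *ᵥ (1 : V → ℝ) = 0 := G.lapMatrix_mulVec_const_eq_zero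
  rw [hzero, Pi.zero_apply, zero_div, mul_eq_zero, sub_eq_zero] at h
  exact (h.resolve_left (Nat.cast_ne_zero.2 (hdeg y).ne')).symm

theorem transitionMatrix_mem_rowStochastic (hdeg : ∀ y, 0 < G.degree y) :
    transitionMatrix G ∈ rowStochastic ℝ V := by
  refine mem_rowStochastic.2 ⟨fun y z => ?_, transitionMatrix_mulVec_one hdeg⟩
  rw [transitionMatrix, of_apply]
  split_ifs <;> positivity

theorem eq_of_transitionMatrix_mulVec_eq_self (hG : G.Preconnected) {f : V → ℝ}
    (hf : transitionMatrix G *ᵥ f = f) (y z : V) : f y = f z := by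
  refine eq_of_dirichletEnergy_eq_zero hG ?_ y z
  have h := wInner_sub_transitionMatrix_mulVec G f
  rw [hf, sub_self, wInner_zero_right] at h
  linarith

end LazyRandomWalk

section ReturnExcess

variable {V : Type*} [Fintype V] (G : SimpleGraph V) [DecidableRel G.Adj]

theorem stationary_eq (x : V) :
    stationary G x = degreeMeasure G x / ∑ y, degreeMeasure G y := by
  have : (Fintype.card V : ℝ) ≠ 0 := Nat.cast_ne_zero.2 (Fintype.card_pos_iff.2 ⟨x⟩).ne'
  rw [stationary, avgDegree, div_mul_cancel₀ _ this]

variable [DecidableEq V]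

/-- The excess `P ^ t (x, x) - π x` of the return probability of the walk over its limit. -/
noncomputable def returnExcess (x : V) (t : ℕ) : ℝ :=
  deviation (degreeMeasure G) (transitionMatrix G) x t x

theorem returnExcess_eq (x : V) (t : ℕ) :
    returnExcess G x t = (transitionMatrix G ^ t) x x - stationary G x := by
  rw [returnExcess, deviation_apply, stationary_eq]

theorem returnExcess_zero_le_one (x : V) : returnExcess G x 0 ≤ 1 := by
  rw [returnExcess, deviation_apply, pow_zero, one_apply_eq]
  exact sub_le_self _ (by positivity)

variable {G}

theorem dirichletEnergy_deviation (hdeg : ∀ y, 0 < G.degree y) (x : V) (t : ℕ) :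
    dirichletEnergy G (deviation (degreeMeasure G) (transitionMatrix G) x t) =
      2 * G.degree x * (returnExcess G x (2 * t) - returnExcess G x (2 * t + 1)) := by
  have hrev := isReversible_transitionMatrix G
  have hP := transitionMatrix_mulVec_one hdeg
  have hsum : ∑ y, degreeMeasure G y ≠ 0 :=
    (sum_pos (fun y _ => Nat.cast_pos.2 (hdeg y)) ⟨x, mem_univ x⟩).ne'
  have hstep : transitionMatrix G *ᵥ deviation (degreeMeasure G) (transitionMatrix G) x t =
      deviation (degreeMeasure G) (transitionMatrix G) x (t + 1) := by
    simpa [add_comm] using pow_mulVec_deviation hP x 1 t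
  have h := wInner_sub_transitionMatrix_mulVec G
    (deviation (degreeMeasure G) (transitionMatrix G) x t)
  rw [hstep, wInner_sub_right, wInner_deviation_deviation hrev hP hsum,
    wInner_deviation_deviation hrev hP hsum, ← add_assoc, ← two_mul] at h
  rw [returnExcess, returnExcess]
  linear_combination -2 * h

variable [Nontrivial V] (hG : G.Preconnected)
include hG

/-- The spectral decomposition of the walk with respect to the degrees. -/
noncomputable def spectralDecomposition :
    SpectralDecomposition (degreeMeasure G) (transitionMatrix G) :=
  (isReversible_transitionMatrix G).spectralDecomposition fun y =>
    Nat.cast_pos.2 (hG.degree_pos_of_nontrivial y)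

theorem lambdaTwo_transitionMatrix_lt_one : lambdaTwo (transitionMatrix G) < 1 :=
  (spectralDecomposition hG).lambdaTwo_lt_one Fintype.one_lt_card
    (transitionMatrix_mulVec_one fun y => hG.degree_pos_of_nontrivial y)
    (fun _ => eq_of_transitionMatrix_mulVec_eq_self hG)
    fun i => ((spectralDecomposition hG).eigenvalue_mem_Icc G i).2

variable (x : V)

theorem returnExcess_nonneg (t : ℕ) : 0 ≤ returnExcess G x t :=
  (spectralDecomposition hG).deviation_self_nonneg
    (transitionMatrix_mulVec_one fun y => hG.degree_pos_of_nontrivial y)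
    (fun _ => eq_of_transitionMatrix_mulVec_eq_self hG) (fun _ => Nat.cast_nonneg _)
    ((spectralDecomposition hG).eigenvalue_mem_Icc G) x t

theorem antitone_returnExcess_sub_succ :
    Antitone fun t => returnExcess G x t - returnExcess G x (t + 1) :=
  (spectralDecomposition hG).antitone_deviation_self_sub_succ
    (transitionMatrix_mulVec_one fun y => hG.degree_pos_of_nontrivial y)
    (fun _ => eq_of_transitionMatrix_mulVec_eq_self hG) (fun _ => Nat.cast_nonneg _)
    ((spectralDecomposition hG).eigenvalue_mem_Icc G) x

theorem returnExcess_succ_le (t : ℕ) :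
    returnExcess G x (t + 1) ≤ lambdaTwo (transitionMatrix G) * returnExcess G x t :=
  (spectralDecomposition hG).deviation_self_succ_le
    (transitionMatrix_mulVec_one fun y => hG.degree_pos_of_nontrivial y)
    (fun _ => eq_of_transitionMatrix_mulVec_eq_self hG) (fun _ => Nat.cast_nonneg _)
    ((spectralDecomposition hG).eigenvalue_mem_Icc G) Fintype.one_lt_card x t

theorem sq_minDegree_mul_returnExcess_pow_three_le (t : ℕ) :
    (G.minDegree : ℝ) ^ 2 * returnExcess G x t ^ 3 ≤
      192 * G.degree x ^ 2 * (returnExcess G x (2 * t) - returnExcess G x (2 * t + 1)) := by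
  have hdeg (y : V) : 0 < G.degree y := hG.degree_pos_of_nontrivial y
  have hm (y : V) : 0 < degreeMeasure G y := Nat.cast_pos.2 (hdeg y)
  have hrev := isReversible_transitionMatrix G
  set f := deviation (degreeMeasure G) (transitionMatrix G) x t
  obtain ⟨y, hy⟩ := exists_deviation_nonpos hrev (transitionMatrix_mulVec_one hdeg) hm x t
  calc (G.minDegree : ℝ) ^ 2 * f x ^ 3
      ≤ 96 * (∑ z, G.degree z * (f z)⁺) * dirichletEnergy G f := nash_inequality hG hy x
    _ ≤ 96 * G.degree x * dirichletEnergy G f := by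
        gcongr
        · exact dirichletEnergy_nonneg G f
        · exact sum_mul_posPart_deviation_le hrev (transitionMatrix_mem_rowStochastic hdeg)
            (fun y => (hm y).le) x t
    _ = 192 * G.degree x ^ 2 * (returnExcess G x (2 * t) - returnExcess G x (2 * t + 1)) := by
        rw [dirichletEnergy_deviation hdeg]
        ring

theorem minDegree_div_degree_mul_returnExcess_pow_three_le (t : ℕ) :
    (G.minDegree / G.degree x * returnExcess G x t) ^ 3 ≤
      192 * (G.minDegree / G.degree x * returnExcess G x t -
        G.minDegree / G.degree x * returnExcess G x (t + 1)) := by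
  have hd : (0 : ℝ) < G.degree x := Nat.cast_pos.2 (hG.degree_pos_of_nontrivial x)
  have hdecr : returnExcess G x (2 * t) - returnExcess G x (2 * t + 1) ≤
      returnExcess G x t - returnExcess G x (t + 1) :=
    antitone_returnExcess_sub_succ hG x (show t ≤ 2 * t by omega)
  calc (G.minDegree / G.degree x * returnExcess G x t) ^ 3
      = G.minDegree / G.degree x ^ 3 * ((G.minDegree : ℝ) ^ 2 * returnExcess G x t ^ 3) := by
        field_simp
    _ ≤ G.minDegree / G.degree x ^ 3 * (192 * G.degree x ^ 2 *
          (returnExcess G x t - returnExcess G x (t + 1))) :=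
        mul_le_mul_of_nonneg_left
          ((sq_minDegree_mul_returnExcess_pow_three_le hG x t).trans (by gcongr)) (by positivity)
    _ = 192 * (G.minDegree / G.degree x * returnExcess G x t -
          G.minDegree / G.degree x * returnExcess G x (t + 1)) := by
        field_simp

theorem returnExcess_le_div_sqrt (t : ℕ) :
    returnExcess G x t ≤ 10 * G.degree x / G.minDegree / √((t : ℝ) + 1) := by
  have hd : (0 : ℝ) < G.degree x := Nat.cast_pos.2 (hG.degree_pos_of_nontrivial x)
  have hδ : (0 : ℝ) < G.minDegree := Nat.cast_pos.2 hG.minDegree_pos_of_nontrivial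
  have hδd : (G.minDegree : ℝ) / G.degree x ≤ 1 :=
    (div_le_one hd).2 (Nat.cast_le.2 (G.minDegree_le_degree x))
  set h : ℕ → ℝ := fun n => G.minDegree / G.degree x * returnExcess G x n with hh
  have hnn (n : ℕ) : 0 ≤ h n := mul_nonneg (by positivity) (returnExcess_nonneg hG x n)
  have h0 : h 0 ≤ 10 :=
    (mul_le_one₀ hδd (returnExcess_nonneg hG x 0) (returnExcess_zero_le_one G x)).trans
      (by norm_num)
  have hstep (n : ℕ) : h n ^ 3 ≤ 2 * 10 ^ 2 * (h n - h (n + 1)) := by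
    have hcube : h n ^ 3 ≤ 192 * (h n - h (n + 1)) :=
      minDegree_div_degree_mul_returnExcess_pow_three_le hG x n
    linarith [pow_nonneg (hnn n) 3]
  have hbound : h t ≤ 10 / √((t : ℝ) + 1) :=
    le_div_sqrt_of_cube_le (by norm_num) hnn h0 hstep t
  calc returnExcess G x t = G.degree x / G.minDegree * h t := by rw [hh]; field_simp
    _ ≤ G.degree x / G.minDegree * (10 / √((t : ℝ) + 1)) := by gcongr
    _ = 10 * G.degree x / G.minDegree / √((t : ℝ) + 1) := by ring

end ReturnExcess

end LazyWalk

theorem mainTheorem4 {V : Type*} [Fintype V] [DecidableEq V]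
    (G : SimpleGraph V) [DecidableRel G.Adj]
    (hconn : G.Connected) (hn : 2 ≤ Fintype.card V) (x : V) (t : ℕ) :
    (LazyWalk.transitionMatrix G ^ t) x x - LazyWalk.stationary G x ≤
      10 * (G.degree x : ℝ) / (G.minDegree : ℝ) *
        min (1 / √((t : ℝ) + 1))
          (√(LazyWalk.relaxationTime G + 1) / ((t : ℝ) + 1)) := by
  have : Nontrivial V := Fintype.one_lt_card_iff_nontrivial.1 hn
  have hG := hconn.preconnected
  rw [← LazyWalk.returnExcess_eq, mul_min_of_nonneg _ _ (by positivity), mul_one_div,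
    ← mul_div_assoc]
  exact le_min (LazyWalk.returnExcess_le_div_sqrt hG x t)
    (LazyWalk.le_sqrt_inv_one_sub_div_of_le_div_sqrt
      (LazyWalk.lambdaTwo_transitionMatrix_lt_one hG) (LazyWalk.returnExcess_nonneg hG x)
      (LazyWalk.returnExcess_succ_le hG x) (LazyWalk.returnExcess_le_div_sqrt hG x) t)
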